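/- **Theorem.** Let $J\subseteq\mathbb R$ be an interval with $0,1\in J$. For $k\in\mathbb Z$ and $x\in\mathbb R$ let $I_k(x)=\frac1\pi\int_0^\pi e^{x\cos\theta}\cos(k\theta)\,d\theta$ be the modified Bessel function. For every $h>0$ let $f^h(t)=(f^h_k(t))_{k\in\mathbb Z}$, $t\in J$, be a complex-valued $\ell^2$ solution of the discrete Schrödinger equation $$\partial_t f_k^h(t)=i\,\frac{f_{k+1}^h(t)-2f_k^h(t)+f_{k-1}^h(t)}{h^2}\qquad(k\in\mathbb Z,\ t\in J),$$ that is, the equation holds for every $k$ and $t$ (with one-sided derivatives at endpoints of $J$ that belong to $J$), and $f^h(t)\in\ell^2(\mathbb Z)$ with $\|f^h(t)\|_{\ell^2}$ bounded for $t$ in compact subsets of $J$. Assume that there are $s>1/2$, $\mu>0$ and $u_0\in H^s(\mathbb R)$ (complex-valued, identified with its continuous representative) such that $$\sum_{k\in\mathbb Z}|f_k^h(0)-u_0(kh)|^2<h^\mu\qquad\text{for all sufficiently small } h>0 .$$ Assume also that there are real numbers $\alpha,\beta$ with $\alpha\beta<4$ and a constant $C$, independent of $h$ and $k$, such that for all $h>0$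 and $k\in\mathbb Z$ $$|f_k^h(0)|\le C\,\frac{I_k(\alpha/h^2)}{I_0(\alpha/h^2)},\qquad |f_k^h(1)|\le C\,\frac{I_k(\beta/h^2)}{I_0(\beta/h^2)} .$$ Then $u_0\equiv 0$ and, for every $t\in J$, $f_k^h(t)\to0$ uniformly in $k\in\mathbb Z$ as $h\to0^+$. -/

import Mathlib

open Filter Topology MeasureTheory
open scoped SchwartzMap

namespace DiscreteHardy

noncomputable section

/-- The modified Bessel function `I_k(x) = (1/π) ∫_0^π e^{x cos θ} cos(kθ) dθ` of integer order `k`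
at a real argument `x`. -/
def besselI (k : ℤ) (x : ℝ) : ℝ :=
  (1 / Real.pi) * ∫ θ in (0 : ℝ)..Real.pi, Real.exp (x * Real.cos θ) * Real.cos (k * θ)

/-- The discrete Laplacian `(g_{k+1} - 2 g_k + g_{k-1}) / h²` with mesh size `h`. -/
def discreteLaplacian (h : ℝ) (g : ℤ → ℂ) (k : ℤ) : ℂ :=
  (g (k + 1) - 2 * g k + g (k - 1)) / (h : ℂ) ^ 2

/-- `f : t ↦ (f_k(t))_k` is an `ℓ²` solution, on the time interval `J`, of the discrete Schrödinger
equation `∂_t f_k = i (f_{k+1} - 2 f_k + f_{k-1}) / h²`: the equation holds for each `k` and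
each `t ∈ J` (with one-sided derivatives at endpoints of `J` that belong to `J`), and the sequences
`f(t)` lie in `ℓ²(ℤ)`, with norms bounded on compact subsets of `J`. -/
structure IsDiscreteSchrodingerSolution (h : ℝ) (J : Set ℝ) (f : ℝ → ℤ → ℂ) : Prop where
  hasDeriv : ∀ k : ℤ, ∀ t ∈ J,
    HasDerivWithinAt (fun τ => f τ k) (Complex.I * discreteLaplacian h (f t) k) J t
  l2_bounded : ∀ K ⊆ J, IsCompact K → ∃ M : ℝ, ∀ t ∈ K,
    Summable (fun k : ℤ => ‖f t k‖ ^ 2) ∧ ∑' k : ℤ, ‖f t k‖ ^ 2 ≤ M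

/-- `u` is a square integrable function that belongs, as a tempered distribution, to the Sobolev
space `H^s(ℝ)`. For `s ≥ 0` this is membership in `H^s(ℝ)`. -/
def MemHs (s : ℝ) (u : ℝ → ℂ) : Prop :=
  ∃ hu : MemLp u 2 (volume : Measure ℝ),
    TemperedDistribution.MemSobolev s 2 ((hu.toLp u : Lp ℂ 2 (volume : Measure ℝ)) : 𝓢'(ℝ, ℂ))

end

end DiscreteHardy

open Filter Topology MeasureTheory
open scoped SchwartzMap
namespace DiscreteHardy

/-! Write x = kh. Shifting the contour of the Bessel integral gives the Chernoff bound
`besselI_div_le`, so the hypotheses bound the data by C exp(γ(cosh(hη) - 1)/h² - |x|η) for every η,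
with γ = α at time 0 and γ = β at time 1. As h → 0 the exponent becomes γη²/2 - |x|η, which is
Gaussian decay expressed through its Legendre transform.

Pairing the solution with plane waves (`fourier_eq`) shows that the Fourier series at times 0 and 1
differ by the factor exp(-i(2 - 2cos θ)/h²). Both series are entire, so θ = hz may be complex, and
the factor tends to exp(-iz²). In the limit the Fourier–Laplace transform G of u₀ is entire, with
|G(z)| at most a constant times exp(α(|Im z| + 1)²/2) and |exp(-iz²) G(z)| at most a constant times
exp(β(|Im z| + 1)²/2). For αβ < 4 this forces G = 0 (`eq_zero_of_hardy`): after a rotation and a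
Gaussian factor, G decays like a Gaussian along two orthogonal axes, and iterated Phragmén–Lindelöf
in a quadrant annihilates such a function.

Once u₀ = 0, the mesh hypothesis says that the ℓ² norm at time 0 is small. It is conserved, and it
dominates the supremum norm at every time. -/

/-! ### Bounds for Bessel functions -/

theorem besselI_zero_pos (x : ℝ) : 0 < besselI 0 x := by
  unfold besselI
  refine mul_pos (by positivity) ?_
  apply intervalIntegral.intervalIntegral_pos_of_pos
  · exact Continuous.intervalIntegrable (by fun_prop) _ _
  · intro θ
    simp only [Int.cast_zero, zero_mul, Real.cos_zero, mul_one]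
    positivity
  · exact Real.pi_pos

theorem besselI_neg_index (k : ℤ) (x : ℝ) : besselI (-k) x = besselI k x := by
  simp [besselI, neg_mul, Real.cos_neg]

/-- For x < 0 one has exp(xc) c ≤ c for every real c, strictly at c = 1, and cos integrates to 0
over [0, π]. -/
theorem besselI_one_neg {x : ℝ} (hx : x < 0) : besselI 1 x < 0 := by
  unfold besselI
  refine mul_neg_of_pos_of_neg (by positivity) ?_
  have key : (∫ θ in (0 : ℝ)..Real.pi, Real.exp (x * Real.cos θ) * Real.cos ((1 : ℤ) * θ))
      < ∫ θ in (0 : ℝ)..Real.pi, Real.cos θ := by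
    have hle : ∀ c : ℝ, Real.exp (x * c) * c ≤ c := by
      intro c
      rcases le_total 0 c with hc | hc
      · have : Real.exp (x * c) ≤ 1 := Real.exp_le_one_iff.2 (by nlinarith)
        nlinarith
      · have : 1 ≤ Real.exp (x * c) := Real.one_le_exp (by nlinarith)
        nlinarith
    refine intervalIntegral.integral_lt_integral_of_continuousOn_of_le_of_exists_lt Real.pi_pos
      (by fun_prop) (by fun_prop) (fun θ _ => by simpa using hle (Real.cos θ))
      ⟨0, ⟨le_rfl, Real.pi_pos.le⟩, ?_⟩
    simpa using hx
  simpa using key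

/-- The contour of the integral defining the Bessel function can be moved to height `η`. -/
theorem integral_besselI_shift (k : ℤ) (x η : ℝ) :
    (∫ θ in (0 : ℝ)..Real.pi, Real.exp (x * Real.cos θ) * Real.cos (k * θ)) =
      (∫ θ in (0 : ℝ)..Real.pi, Complex.exp (x * Complex.cos (θ + η * Complex.I)) *
        Complex.exp (Complex.I * k * (θ + η * Complex.I))).re := by
  set g : ℂ → ℂ := fun z => Complex.exp (x * Complex.cos z) * Complex.exp (Complex.I * k * z)
    with hg
  have hgd : Differentiable ℂ g := by
    rw [hg]; fun_prop
  have hgc : Continuous g := hgd.continuous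
  have h := Complex.integral_boundary_rect_eq_zero_of_differentiableOn g 0 (Real.pi + η * Complex.I)
    hgd.differentiableOn
  -- The integrand is real on the vertical sides Re z = 0 and Re z = π, so their contributions i ∫
  -- are purely imaginary and drop out of the real part.
  have hside : ∀ y : ℝ, ∀ c : ℝ, (c = 0 ∨ c = Real.pi) →
      ∃ r : ℝ, g (c + y * Complex.I) = r := by
    rintro y c (rfl | rfl)
    · refine ⟨Real.exp (x * Real.cosh y) * Real.exp (-(k * y)), ?_⟩
      have e : Complex.I * k * (y * Complex.I) = -(k * y) := by
        linear_combination (k * y : ℂ) * Complex.I_mul_I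
      simp only [hg, Complex.ofReal_zero, zero_add, Complex.cos_mul_I, e]
      push_cast
      rfl
    · refine ⟨Real.exp (x * -Real.cosh y) * (Real.exp (-(k * y)) * (-1) ^ k), ?_⟩
      have e : Complex.I * k * (Real.pi + y * Complex.I) =
          -(k * y) + k * (Real.pi * Complex.I) := by
        linear_combination (k * y : ℂ) * Complex.I_mul_I
      have e2 : Complex.cos (Real.pi + y * Complex.I) = -Complex.cosh y := by
        rw [Complex.cos_add, Complex.cos_pi, Complex.sin_pi, Complex.cos_mul_I]; ring
      simp only [hg, e, e2, Complex.exp_add, Complex.exp_int_mul, Complex.exp_pi_mul_I]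
      push_cast
      rfl
  have hre : ∀ c : ℝ, (c = 0 ∨ c = Real.pi) → ∀ a b : ℝ,
      (Complex.I • ∫ y in a..b, g (c + y * Complex.I)).re = 0 := by
    intro c hc a b
    choose r hr using fun y => hside y c hc
    simp only [hr]
    rw [intervalIntegral.integral_ofReal]
    simp
  have hr := congrArg Complex.re h
  simp only [Complex.add_re, Complex.sub_re, Complex.zero_re, Complex.zero_im, Complex.add_im,
    Complex.ofReal_re, Complex.ofReal_im, Complex.mul_re, Complex.mul_im, Complex.I_re,
    Complex.I_im, mul_zero, mul_one, zero_add, add_zero, sub_zero, Complex.ofReal_zero,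
    zero_mul] at hr
  have h1 := hre 0 (Or.inl rfl) 0 η
  have h2 := hre Real.pi (Or.inr rfl) 0 η
  simp only [Complex.ofReal_zero, zero_add] at h1
  rw [h1, h2] at hr
  have h3 : (∫ θ in (0 : ℝ)..Real.pi, g θ).re =
      ∫ θ in (0 : ℝ)..Real.pi, Real.exp (x * Real.cos θ) * Real.cos (k * θ) := by
    rw [← RCLike.re_eq_complex_re, ← intervalIntegral.intervalIntegral_re]
    · refine intervalIntegral.integral_congr fun θ _ => ?_
      have e1 : (x : ℂ) * Complex.cos θ = ((x * Real.cos θ : ℝ) : ℂ) := by push_cast; rfl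
      have e2 : Complex.I * k * θ = ((k * θ : ℝ) : ℂ) * Complex.I := by push_cast; ring
      simp only [hg, e1, e2, RCLike.re_eq_complex_re, ← Complex.ofReal_exp,
        Complex.re_ofReal_mul, Complex.exp_ofReal_mul_I_re]
    · exact (hgc.comp Complex.continuous_ofReal).intervalIntegrable _ _
  rw [← h3]
  linarith

/-- At height η the integrand has modulus exp(x cos θ cosh η - kη). Since (1 - cos θ)(cosh η - 1) ≥
0, cos θ cosh η ≤ cos θ + cosh η - 1, which splits off the integrand of I₀. -/
theorem abs_besselI_le (k : ℤ) {x : ℝ} (hx : 0 ≤ x) (η : ℝ) :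
    |besselI k x| ≤ besselI 0 x * Real.exp (x * (Real.cosh η - 1) - k * η) := by
  unfold besselI
  rw [abs_mul, abs_of_pos (by positivity : 0 < 1 / Real.pi), mul_assoc,
    integral_besselI_shift k x η]
  refine mul_le_mul_of_nonneg_left ?_ (by positivity)
  refine (Complex.abs_re_le_norm _).trans ?_
  rw [← intervalIntegral.integral_mul_const]
  refine intervalIntegral.norm_integral_le_of_norm_le Real.pi_pos.le ?_
    (Continuous.intervalIntegrable (by fun_prop) _ _)
  refine Eventually.of_forall fun θ _ => ?_
  rw [norm_mul, Complex.norm_exp, Complex.norm_exp]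
  have e1 : ((x : ℂ) * Complex.cos (θ + η * Complex.I)).re =
      x * (Real.cos θ * Real.cosh η) := by
    rw [Complex.re_ofReal_mul, Complex.cos_add, Complex.cos_mul_I, Complex.sin_mul_I]
    simp [← Complex.ofReal_cos, ← Complex.ofReal_cosh, ← Complex.ofReal_sin, ← Complex.ofReal_sinh]
  have e2 : (Complex.I * k * (θ + η * Complex.I)).re = -(k * η) := by simp
  rw [e1, e2]
  simp only [Int.cast_zero, zero_mul, Real.cos_zero, mul_one]
  rw [← Real.exp_add, ← Real.exp_add]
  refine Real.exp_le_exp.2 ?_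
  have h1 := Real.cos_le_one θ
  have h2 := Real.one_le_cosh η
  nlinarith [mul_nonneg hx (mul_nonneg (sub_nonneg.2 h1) (sub_nonneg.2 h2))]

/-- Chernoff-type bound for the normalised Bessel functions. -/
theorem besselI_div_le (k : ℤ) {x η : ℝ} (hx : 0 ≤ x) :
    besselI k x / besselI 0 x ≤ Real.exp (x * (Real.cosh η - 1) - |(k : ℝ)| * η) := by
  rw [div_le_iff₀' (besselI_zero_pos x)]
  rcases abs_cases (k : ℝ) with ⟨h, _⟩ | ⟨h, _⟩
  · rw [h]
    exact (le_abs_self _).trans (abs_besselI_le k hx η)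
  · rw [h, ← besselI_neg_index]
    have := abs_besselI_le (-k) hx η
    push_cast at this
    exact (le_abs_self _).trans this

/-! ### Phragmén–Lindelöf and Hardy's uncertainty principle -/

theorem norm_exp_mul_exp_sq (p q : ℝ) (s : ℂ) :
    ‖Complex.exp ((-p + q * Complex.I) * Complex.exp s ^ 2)‖ =
      Real.exp (-(Real.exp (2 * s.re) * (p * Real.cos (2 * s.im) + q * Real.sin (2 * s.im)))) := by
  rw [Complex.norm_exp, ← Complex.exp_nat_mul]
  congr 1
  simp only [Complex.mul_re, Complex.exp_re, Complex.exp_im, Complex.add_re, Complex.add_im,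
    Complex.neg_re, Complex.neg_im, Complex.ofReal_re, Complex.ofReal_im, Complex.mul_im,
    Complex.I_re, Complex.I_im]
  simp
  ring

/-- Phragmén–Lindelöf for an entire function of order at most two, in a sector of opening less
than a right angle, in logarithmic coordinates and relative to an exponential `exp (c z²)`. -/
theorem norm_comp_exp_le_of_sector {H : ℂ → ℂ} (hH : Differentiable ℂ H) {M D : ℝ} (hM : 0 ≤ M)
    (hD : 0 ≤ D) (hgrow : ∀ z, ‖H z‖ ≤ M * Real.exp (D * ‖z‖ ^ 2)) (p q : ℝ) {a b : ℝ}
    (hab : a < b) (hba : b - a < Real.pi / 2)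
    (hedge : ∀ s : ℂ, s.im = a ∨ s.im = b → ‖H (Complex.exp s)‖ ≤
      M * Real.exp (Real.exp (2 * s.re) * (p * Real.cos (2 * s.im) + q * Real.sin (2 * s.im))))
    {s : ℂ} (ha : a ≤ s.im) (hb : s.im ≤ b) : ‖H (Complex.exp s)‖ ≤
      M * Real.exp (Real.exp (2 * s.re) * (p * Real.cos (2 * s.im) + q * Real.sin (2 * s.im))) := by
  set F : ℂ → ℂ := fun s => H (Complex.exp s) *
    Complex.exp ((-p + q * Complex.I) * Complex.exp s ^ 2) with hF
  have hnorm : ∀ s, ‖F s‖ ≤ M ↔ ‖H (Complex.exp s)‖ ≤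
      M * Real.exp (Real.exp (2 * s.re) *
        (p * Real.cos (2 * s.im) + q * Real.sin (2 * s.im))) := by
    intro s
    rw [hF, norm_mul, norm_exp_mul_exp_sq, Real.exp_neg, ← div_eq_mul_inv,
      div_le_iff₀ (Real.exp_pos _)]
  have hFd : Differentiable ℂ F := by
    rw [hF]
    exact (hH.comp Complex.differentiable_exp).mul (by fun_prop)
  rw [← hnorm]
  -- Order two in z becomes growth exp(const · exp(2|Re s|)) in s = log z, admissible because 2 <
  -- π/(b - a).
  refine PhragmenLindelof.horizontal_strip (a := a) (b := b) hFd.diffContOnCl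
    ⟨2, ?_, D + (|p| + |q|), Asymptotics.IsBigO.of_bound M (Eventually.of_forall fun z => ?_)⟩
    (fun z hz => (hnorm z).2 (hedge z (Or.inl hz))) (fun z hz => (hnorm z).2 (hedge z (Or.inr hz)))
    ha hb
  · rw [lt_div_iff₀ (by linarith)]
    linarith
  · have e0 : ‖Complex.exp z‖ ^ 2 = Real.exp (2 * z.re) := by
      rw [Complex.norm_exp, ← Real.exp_nat_mul]; norm_num
    have h1 := hgrow (Complex.exp z)
    rw [e0] at h1
    have hle : Real.exp (2 * z.re) ≤ Real.exp (2 * |z.re|) :=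
      Real.exp_le_exp.2 (by linarith [le_abs_self z.re])
    have hpos := Real.exp_pos (2 * z.re)
    have hp : -(p * Real.cos (2 * z.im)) ≤ |p| := by
      refine (neg_le_abs _).trans ?_
      rw [abs_mul]
      exact mul_le_of_le_one_right (abs_nonneg _) (Real.abs_cos_le_one _)
    have hq : -(q * Real.sin (2 * z.im)) ≤ |q| := by
      refine (neg_le_abs _).trans ?_
      rw [abs_mul]
      exact mul_le_of_le_one_right (abs_nonneg _) (Real.abs_sin_le_one _)
    rw [hF, norm_mul, norm_exp_mul_exp_sq, Real.norm_of_nonneg (Real.exp_pos _).le]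
    refine (mul_le_mul_of_nonneg_right h1 (Real.exp_pos _).le).trans ?_
    rw [mul_assoc, ← Real.exp_add]
    refine mul_le_mul_of_nonneg_left (Real.exp_le_exp.2 ?_) hM
    calc D * Real.exp (2 * z.re) + -(Real.exp (2 * z.re) *
            (p * Real.cos (2 * z.im) + q * Real.sin (2 * z.im)))
        = Real.exp (2 * z.re) * (D + (-(p * Real.cos (2 * z.im)) + -(q * Real.sin (2 * z.im)))) := by
          ring
      _ ≤ Real.exp (2 * z.re) * (D + (|p| + |q|)) := by gcongr
      _ ≤ (D + (|p| + |q|)) * Real.exp (2 * |z.re|) := by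
          rw [mul_comm]
          gcongr

/-- An entire function of order two and finite type that has Gaussian decay along two orthogonal
rays vanishes. -/
theorem eq_zero_of_gaussian_decay_on_axes {H : ℂ → ℂ} (hH : Differentiable ℂ H) {M D a : ℝ}
    (hM : 0 ≤ M) (hD : 0 ≤ D) (ha : 0 < a) (hgrow : ∀ z, ‖H z‖ ≤ M * Real.exp (D * ‖z‖ ^ 2))
    (hx : ∀ x : ℝ, ‖H x‖ ≤ M * Real.exp (-a * x ^ 2))
    (hy : ∀ y : ℝ, ‖H (y * Complex.I)‖ ≤ M * Real.exp (-a * y ^ 2)) (z : ℂ) : H z = 0 := by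
  have hpi := Real.pi_pos
  have sector := fun p q a b => norm_comp_exp_le_of_sector hH hM hD hgrow p q (a := a) (b := b)
  have hexp2 : ∀ u : ℝ, Real.exp u ^ 2 = Real.exp (2 * u) := by
    intro u; rw [← Real.exp_nat_mul]; norm_num
  have edge0 : ∀ s : ℂ, s.im = 0 → ‖H (Complex.exp s)‖ ≤
      M * Real.exp (Real.exp (2 * s.re) * -a) := by
    intro s hs
    have e : Complex.exp s = (Real.exp s.re : ℝ) := by
      conv_lhs => rw [← Complex.re_add_im s, hs]
      simp
    have := hx (Real.exp s.re)
    rwa [hexp2, mul_comm (-a), ← e] at this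
  have edge1 : ∀ s : ℂ, s.im = Real.pi / 2 → ‖H (Complex.exp s)‖ ≤
      M * Real.exp (Real.exp (2 * s.re) * -a) := by
    intro s hs
    have e : Complex.exp s = (Real.exp s.re : ℝ) * Complex.I := by
      conv_lhs => rw [← Complex.re_add_im s, hs]
      rw [Complex.exp_add]
      push_cast
      rw [Complex.exp_pi_div_two_mul_I]
    have := hy (Real.exp s.re)
    rwa [hexp2, mul_comm (-a), ← e] at this
  have mono : ∀ (N r c d : ℝ), c ≤ d → N ≤ M * Real.exp (Real.exp r * c) →
      N ≤ M * Real.exp (Real.exp r * d) := by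
    intro N r c d hcd hN
    refine hN.trans (mul_le_mul_of_nonneg_left (Real.exp_le_exp.2 ?_) hM)
    exact mul_le_mul_of_nonneg_left hcd (Real.exp_pos _).le
  have a1 : 2 * (Real.pi / 4) = Real.pi / 2 := by ring
  have a2 : 2 * (Real.pi / 2) = Real.pi := by ring
  have a3 : 2 * (Real.pi / 8) = Real.pi / 4 := by ring
  have a4 : 2 * (3 * Real.pi / 8) = Real.pi - Real.pi / 4 := by ring
  -- A quadrant has exactly the critical opening for order two, so it is cut along its diagonal,
  -- where sin(2 Im s) = 1 and the crude growth bound serves as edge estimate.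
  have base : ∀ s : ℂ, 0 ≤ s.im → s.im ≤ Real.pi / 2 → ‖H (Complex.exp s)‖ ≤
      M * Real.exp (Real.exp (2 * s.re) * (D * Real.sin (2 * s.im))) := by
    have mid : ∀ s : ℂ, s.im = Real.pi / 4 → ‖H (Complex.exp s)‖ ≤
        M * Real.exp (Real.exp (2 * s.re) * D) := by
      intro s hs
      have := hgrow (Complex.exp s)
      rwa [Complex.norm_exp, hexp2, mul_comm D] at this
    intro s h0 h1
    rcases le_total s.im (Real.pi / 4) with h | h
    · refine mono _ _ _ _ ?_ (sector 0 D 0 (Real.pi / 4) (by linarith) (by linarith) ?_ h0 h)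
      · simp
      · rintro w (hw | hw)
        · refine mono _ _ _ _ ?_ (edge0 w hw)
          simp [hw, ha.le]
        · refine mono _ _ _ _ ?_ (mid w hw)
          simp [hw, a1]
    · refine mono _ _ _ _ ?_
        (sector 0 D (Real.pi / 4) (Real.pi / 2) (by linarith) (by linarith) ?_ h h1)
      · simp
      · rintro w (hw | hw)
        · refine mono _ _ _ _ ?_ (mid w hw)
          simp [hw, a1]
        · refine mono _ _ _ _ ?_ (edge1 w hw)
          simp [hw, a2, ha.le]
  -- A bound of type K sin 2φ improves to (K - a) sin 2φ. The decay on the axes gives type K sin 2φ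
  -- ∓ a cos 2φ on the two halves of the quadrant. At φ = π/8 and 3π/8 this equals (K - a) sin 2φ,
  -- so the sector between them inherits that type; outside it, |cos 2φ| ≥ sin 2φ suffices.
  -- Iterating sends the type to -∞ in the open quadrant.
  have step : ∀ K : ℝ, (∀ s : ℂ, 0 ≤ s.im → s.im ≤ Real.pi / 2 → ‖H (Complex.exp s)‖ ≤
      M * Real.exp (Real.exp (2 * s.re) * (K * Real.sin (2 * s.im)))) →
      ∀ s : ℂ, 0 ≤ s.im → s.im ≤ Real.pi / 2 → ‖H (Complex.exp s)‖ ≤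
      M * Real.exp (Real.exp (2 * s.re) * ((K - a) * Real.sin (2 * s.im))) := by
    intro K hK
    have low : ∀ s : ℂ, 0 ≤ s.im → s.im ≤ Real.pi / 4 → ‖H (Complex.exp s)‖ ≤
        M * Real.exp (Real.exp (2 * s.re) *
          (-a * Real.cos (2 * s.im) + K * Real.sin (2 * s.im))) := by
      intro s h0 h
      refine sector (-a) K 0 (Real.pi / 4) (by linarith) (by linarith) ?_ h0 h
      rintro w (hw | hw)
      · refine mono _ _ _ _ ?_ (edge0 w hw)
        simp [hw]
      · refine mono _ _ _ _ ?_ (hK w (by rw [hw]; positivity) (by rw [hw]; linarith))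
        simp [hw, a1]
    have high : ∀ s : ℂ, Real.pi / 4 ≤ s.im → s.im ≤ Real.pi / 2 → ‖H (Complex.exp s)‖ ≤
        M * Real.exp (Real.exp (2 * s.re) *
          (a * Real.cos (2 * s.im) + K * Real.sin (2 * s.im))) := by
      intro s h h1
      refine sector a K (Real.pi / 4) (Real.pi / 2) (by linarith) (by linarith) ?_ h h1
      rintro w (hw | hw)
      · refine mono _ _ _ _ ?_ (hK w (by rw [hw]; positivity) (by rw [hw]; linarith))
        simp [hw, a1]
      · refine mono _ _ _ _ ?_ (edge1 w hw)
        simp [hw, a2]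
    have hcs : ∀ v : ℝ, 0 ≤ v → v ≤ Real.pi / 4 → Real.sin v ≤ Real.cos v := by
      intro v h0 h1
      rw [← Real.cos_pi_div_two_sub]
      exact Real.cos_le_cos_of_nonneg_of_le_pi h0 (by linarith) (by linarith)
    intro s h0 h1
    rcases le_total s.im (Real.pi / 8) with h | h
    · refine mono _ _ _ _ ?_ (low s h0 (by linarith))
      nlinarith [hcs (2 * s.im) (by linarith) (by linarith)]
    rcases le_total s.im (3 * Real.pi / 8) with h' | h'
    · refine mono _ _ _ _ ?_
        (sector 0 (K - a) (Real.pi / 8) (3 * Real.pi / 8) (by linarith) (by linarith) ?_ h h')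
      · simp
      · rintro w (hw | hw)
        · refine mono _ _ _ _ ?_ (low w (by rw [hw]; positivity) (by rw [hw]; linarith))
          rw [hw, a3, Real.cos_pi_div_four, Real.sin_pi_div_four]
          linarith
        · refine mono _ _ _ _ ?_ (high w (by rw [hw]; linarith) (by rw [hw]; linarith))
          rw [hw, a4, Real.cos_pi_sub, Real.sin_pi_sub, Real.cos_pi_div_four,
            Real.sin_pi_div_four]
          linarith
    · refine mono _ _ _ _ ?_ (high s (by linarith) h1)
      have := hcs (Real.pi - 2 * s.im) (by linarith) (by linarith)
      rw [Real.sin_pi_sub, Real.cos_pi_sub] at this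
      nlinarith
  have iter : ∀ (n : ℕ) (s : ℂ), 0 ≤ s.im → s.im ≤ Real.pi / 2 → ‖H (Complex.exp s)‖ ≤
      M * Real.exp (Real.exp (2 * s.re) * ((D - n * a) * Real.sin (2 * s.im))) := by
    intro n
    induction n with
    | zero => simpa using base
    | succ n ih =>
      have := step _ ih
      have e : D - ((n + 1 : ℕ) : ℝ) * a = D - n * a - a := by push_cast; ring
      rwa [e]
  have vanish : ∀ s : ℂ, 0 < s.im → s.im < Real.pi / 2 → H (Complex.exp s) = 0 := by
    intro s h0 h1
    have hsin : 0 < Real.sin (2 * s.im) := Real.sin_pos_of_pos_of_lt_pi (by linarith) (by linarith)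
    have hlim : Tendsto (fun n : ℕ => M * Real.exp (Real.exp (2 * s.re) *
        ((D - n * a) * Real.sin (2 * s.im)))) atTop (𝓝 (M * 0)) := by
      refine (Real.tendsto_exp_atBot.comp ?_).const_mul M
      refine Tendsto.const_mul_atBot (Real.exp_pos _) (Tendsto.atBot_mul_const hsin ?_)
      exact tendsto_atBot_add_const_left _ D
        (tendsto_neg_atTop_atBot.comp (tendsto_natCast_atTop_atTop.atTop_mul_const ha)) |>.congr
        fun n => by simp [sub_eq_add_neg]
    rw [mul_zero] at hlim
    exact norm_le_zero_iff.1 (ge_of_tendsto' hlim fun n => iter n s h0.le h1.le)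
  have hcomp : (fun s => H (Complex.exp s)) = fun _ => 0 := by
    have h1 : AnalyticOnNhd ℂ (fun s => H (Complex.exp s)) Set.univ :=
      (hH.comp Complex.differentiable_exp).differentiableOn.analyticOnNhd isOpen_univ
    refine h1.eq_of_eventuallyEq (z₀ := (Real.pi / 4 : ℝ) * Complex.I) analyticOnNhd_const ?_
    have him : ((Real.pi / 4 : ℝ) * Complex.I : ℂ).im = Real.pi / 4 := by simp
    filter_upwards [Complex.continuous_im.continuousAt.eventually_const_lt
      (show 0 < ((Real.pi / 4 : ℝ) * Complex.I : ℂ).im by rw [him]; positivity),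
      Complex.continuous_im.continuousAt.eventually_lt_const
      (show ((Real.pi / 4 : ℝ) * Complex.I : ℂ).im < Real.pi / 2 by rw [him]; linarith)]
      with s h0 h1 using vanish s h0 h1
  have hne : ∀ z : ℂ, z ≠ 0 → H z = 0 := fun z hz => by
    simpa [Complex.exp_log hz] using congrFun hcomp (Complex.log z)
  rcases eq_or_ne z 0 with rfl | hz
  · have h := hx 0
    have hlim : Tendsto H (𝓝[≠] 0) (𝓝 (H 0)) := hH.continuous.continuousAt.tendsto.mono_left
      nhdsWithin_le_nhds
    refine tendsto_nhds_unique hlim (tendsto_const_nhds.congr' ?_)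
    filter_upwards [self_mem_nhdsWithin] with w hw using (hne w hw).symm
  · exact hne z hz

/-- Hardy's uncertainty principle below the critical exponent, in terms of the Fourier–Laplace
transform `G` of the initial datum and that of the solution at time one, `exp (-iz²) G`. -/
theorem eq_zero_of_hardy {G : ℂ → ℂ} (hG : Differentiable ℂ G) {α β K : ℝ} (hα : 0 ≤ α)
    (hβ : 0 ≤ β) (hαβ : α * β < 4) (hK : 0 ≤ K)
    (h0 : ∀ z : ℂ, ‖G z‖ ≤ K * Real.exp (α * (|z.im| + 1) ^ 2 / 2))
    (h1 : ∀ z : ℂ, ‖Complex.exp (-Complex.I * z ^ 2) * G z‖ ≤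
      K * Real.exp (β * (|z.im| + 1) ^ 2 / 2)) (z : ℂ) : G z = 0 := by
  -- The strict inequality leaves room to make both rates positive and to absorb the shift in (|Im
  -- z| + 1)² into a factor 1 + ε and a constant.
  obtain ⟨ε, hε, hε4⟩ : ∃ ε : ℝ, 0 < ε ∧ ((α + ε) * (1 + ε)) * ((β + ε) * (1 + ε)) < 4 := by
    have hc : ContinuousAt (fun ε : ℝ => ((α + ε) * (1 + ε)) * ((β + ε) * (1 + ε))) 0 := by
      fun_prop
    have := hc.eventually_lt_const (show _ < (4 : ℝ) by simpa using hαβ)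
    have := (this.filter_mono nhdsWithin_le_nhds : ∀ᶠ ε in 𝓝[>] (0 : ℝ), _)
    obtain ⟨ε, h, hε⟩ := (this.and self_mem_nhdsWithin).exists
    exact ⟨ε, hε, h⟩
  set A := (α + ε) * (1 + ε) with hA
  set B := (β + ε) * (1 + ε) with hB
  have hA0 : 0 < A := by positivity
  have hB0 : 0 < B := by positivity
  have hsq : ∀ γ y : ℝ, 0 ≤ γ → γ * (y + 1) ^ 2 / 2 ≤
      (γ + ε) * (1 + ε) * y ^ 2 / 2 + (γ + ε) * (1 + 1 / ε) / 2 := by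
    intro γ y hγ
    have h : (y + 1) ^ 2 ≤ (1 + ε) * y ^ 2 + (1 + 1 / ε) := by
      have : (1 + ε) * y ^ 2 + (1 + 1 / ε) - (y + 1) ^ 2 = (ε * y - 1) ^ 2 / ε := by
        field_simp
        ring
      have h2 : 0 ≤ (ε * y - 1) ^ 2 / ε := by positivity
      linarith
    calc γ * (y + 1) ^ 2 / 2 ≤ (γ + ε) * (y + 1) ^ 2 / 2 := by gcongr; linarith
      _ ≤ (γ + ε) * ((1 + ε) * y ^ 2 + (1 + 1 / ε)) / 2 := by gcongr
      _ = _ := by ring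
  set L := K * Real.exp ((α + ε) * (1 + 1 / ε) / 2 + (β + ε) * (1 + 1 / ε) / 2) with hL
  have hL0 : 0 ≤ L := by positivity
  have b0 : ∀ z : ℂ, ‖G z‖ ≤ L * Real.exp (A * z.im ^ 2 / 2) := by
    intro z
    refine (h0 z).trans ?_
    rw [hL, mul_assoc, ← Real.exp_add]
    refine mul_le_mul_of_nonneg_left (Real.exp_le_exp.2 ?_) hK
    have := hsq α |z.im| hα
    rw [sq_abs] at this
    have h2 : 0 ≤ (β + ε) * (1 + 1 / ε) / 2 := by positivity
    linarith
  have b1 : ∀ z : ℂ, ‖G z‖ ≤ L * Real.exp (B * z.im ^ 2 / 2 - 2 * z.re * z.im) := by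
    intro z
    have h := h1 z
    have e : (-Complex.I * z ^ 2).re = 2 * z.re * z.im := by
      simp [sq]
      ring
    rw [norm_mul, Complex.norm_exp, e] at h
    have : ‖G z‖ ≤ K * Real.exp (β * (|z.im| + 1) ^ 2 / 2) * Real.exp (-(2 * z.re * z.im)) := by
      rw [Real.exp_neg, ← div_eq_mul_inv, le_div_iff₀' (Real.exp_pos _)]
      exact h
    refine this.trans ?_
    rw [hL, mul_assoc K, mul_assoc K, ← Real.exp_add, ← Real.exp_add]
    refine mul_le_mul_of_nonneg_left (Real.exp_le_exp.2 ?_) hK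
    have := hsq β |z.im| hβ
    rw [sq_abs] at this
    have h2 : 0 ≤ (α + ε) * (1 + 1 / ε) / 2 := by positivity
    linarith
  -- Along the line ℝω the term -2 Re z Im z wins: the second bound has exponent -2B x² at z = ωx.
  -- On the orthogonal line the first bound has exponent AB² y²/2 at z = iωy.
  set ω : ℂ := B + 2 * Complex.I with hω
  have hω0 : ω ≠ 0 := by
    intro h
    have := congrArg Complex.im h
    simp [hω] at this
  -- The factor exp(cz²) adds c on the first axis and subtracts it on the second. This c equalises c
  -- - 2B and AB²/2 - c; both become -B(4 - AB)/4, negative exactly because AB < 4.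
  set c : ℝ := B + A * B ^ 2 / 4 with hc
  have hgap : 0 < B * (4 - A * B) / 4 := by
    have : 0 < 4 - A * B := by linarith
    positivity
  have him : ∀ z : ℂ, (ω * z).im = B * z.im + 2 * z.re := by intro z; simp [hω]
  have hre : ∀ z : ℂ, (ω * z).re = B * z.re - 2 * z.im := by intro z; simp [hω]
  have hcn : ∀ z : ℂ, ‖Complex.exp (c * z ^ 2)‖ = Real.exp (c * (z.re ^ 2 - z.im ^ 2)) := by
    intro z
    rw [Complex.norm_exp, Complex.re_ofReal_mul]
    simp [sq]
  have key := eq_zero_of_gaussian_decay_on_axes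
    (H := fun z => G (ω * z) * Complex.exp (c * z ^ 2)) (M := L)
    (D := A * (B ^ 2 + 4) + c) (a := B * (4 - A * B) / 4)
    ((hG.comp (by fun_prop)).mul (by fun_prop)) hL0 (by positivity) hgap ?_ ?_ ?_ (z / ω)
  · simpa [mul_div_cancel₀ _ hω0] using key
  · intro z
    rw [norm_mul, hcn]
    refine (mul_le_mul_of_nonneg_right (b0 _) (Real.exp_pos _).le).trans ?_
    rw [mul_assoc, ← Real.exp_add]
    refine mul_le_mul_of_nonneg_left (Real.exp_le_exp.2 ?_) hL0
    rw [him, ← Complex.normSq_eq_norm_sq, Complex.normSq_apply]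
    have t1 : (B * z.im + 2 * z.re) ^ 2 / 2 ≤ (B ^ 2 + 4) * (z.re * z.re + z.im * z.im) := by
      nlinarith [sq_nonneg (B * z.im - 2 * z.re), mul_nonneg (sq_nonneg B) (sq_nonneg z.re),
        sq_nonneg z.im]
    have t2 := mul_le_mul_of_nonneg_left t1 hA0.le
    have t3 : 0 ≤ c * z.im ^ 2 := by positivity
    nlinarith
  · intro x
    rw [norm_mul, hcn]
    refine (mul_le_mul_of_nonneg_right (b1 _) (Real.exp_pos _).le).trans ?_
    rw [mul_assoc, ← Real.exp_add]
    refine mul_le_mul_of_nonneg_left (Real.exp_le_exp.2 (le_of_eq ?_)) hL0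
    rw [him, hre]
    simp only [Complex.ofReal_re, Complex.ofReal_im, hc]
    ring
  · intro y
    rw [norm_mul, hcn]
    refine (mul_le_mul_of_nonneg_right (b0 _) (Real.exp_pos _).le).trans ?_
    rw [mul_assoc, ← Real.exp_add]
    refine mul_le_mul_of_nonneg_left (Real.exp_le_exp.2 (le_of_eq ?_)) hL0
    rw [him]
    simp only [Complex.mul_re, Complex.mul_im, Complex.ofReal_re, Complex.ofReal_im,
      Complex.I_re, Complex.I_im, hc]
    ring

/-! ### Conserved pairings and the Fourier multiplier -/

/-- The piecewise linear cutoff that is `1` at `0` and vanishes for `|k| > N`. -/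
noncomputable def tent (N : ℕ) (k : ℤ) : ℝ := max 0 (1 - |(k : ℝ)| / (N + 1))

theorem tent_nonneg (N : ℕ) (k : ℤ) : 0 ≤ tent N k := le_max_left _ _

theorem tent_le_one (N : ℕ) (k : ℤ) : tent N k ≤ 1 :=
  max_le zero_le_one (sub_le_self _ (by positivity))

theorem tent_eq_zero {N : ℕ} {k : ℤ} (hk : (N + 1 : ℝ) ≤ |(k : ℝ)|) : tent N k = 0 := by
  refine max_eq_left ?_
  rw [sub_nonpos, le_div_iff₀ (by positivity)]
  simpa using hk

theorem abs_tent_sub_le (N : ℕ) (k : ℤ) : |tent N k - tent N (k + 1)| ≤ 1 / (N + 1) := by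
  have e : (1 - |(k : ℝ)| / (N + 1)) - (1 - |((k + 1 : ℤ) : ℝ)| / (N + 1)) =
      (|((k + 1 : ℤ) : ℝ)| - |(k : ℝ)|) / (N + 1) := by ring
  unfold tent
  rw [max_comm 0, max_comm 0]
  refine (abs_max_sub_max_le_abs _ _ (0 : ℝ)).trans ?_
  rw [e, abs_div, abs_of_pos (by positivity : (0 : ℝ) < N + 1)]
  gcongr
  refine (abs_abs_sub_abs_le _ _).trans ?_
  simp

theorem tendsto_tent (k : ℤ) : Tendsto (fun N => tent N k) atTop (𝓝 1) := by
  have h : Tendsto (fun N : ℕ => 1 - |(k : ℝ)| / ((N : ℝ) + 1)) atTop (𝓝 (1 - 0)) :=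
    tendsto_const_nhds.sub ((tendsto_const_nhds (x := |(k : ℝ)|)).div_atTop
      (tendsto_atTop_add_const_right _ _ tendsto_natCast_atTop_atTop))
  simpa [tent] using (tendsto_const_nhds (x := (0 : ℝ))).max h

/-- Summation by parts against the tent cutoff. -/
theorem sum_tent_mul_sub (N : ℕ) (d : ℤ → ℂ) :
    ∑ k ∈ Finset.Icc (-N : ℤ) N, (tent N k : ℂ) * (d k - d (k - 1)) =
      ∑ k ∈ Finset.Icc (-N - 1 : ℤ) N, ((tent N k - tent N (k + 1) : ℝ) : ℂ) * d k := by
  -- The tent vanishes at ±(N + 1), so the ranges can be extended by one site and no boundary terms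
  -- arise.
  have h1 : ∑ k ∈ Finset.Icc (-N : ℤ) N, (tent N k : ℂ) * d k =
      ∑ k ∈ Finset.Icc (-N - 1 : ℤ) N, (tent N k : ℂ) * d k := by
    refine Finset.sum_subset (Finset.Icc_subset_Icc (by omega) le_rfl) fun k hk hk' => ?_
    simp only [Finset.mem_Icc] at hk hk'
    have : k = -N - 1 := by omega
    rw [tent_eq_zero, Complex.ofReal_zero, zero_mul]
    subst this
    push_cast
    rw [show (-(N : ℝ) - 1) = -(N + 1) by ring, abs_neg]
    exact le_abs_self _
  have h2 : ∑ k ∈ Finset.Icc (-N : ℤ) N, (tent N k : ℂ) * d (k - 1) =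
      ∑ k ∈ Finset.Icc (-N - 1 : ℤ) N, (tent N (k + 1) : ℂ) * d k := by
    have h3 : ∑ k ∈ Finset.Icc (-N - 1 : ℤ) (N - 1), (tent N (k + 1) : ℂ) * d k =
        ∑ k ∈ Finset.Icc (-N - 1 : ℤ) N, (tent N (k + 1) : ℂ) * d k := by
      refine Finset.sum_subset (Finset.Icc_subset_Icc le_rfl (by omega)) fun k hk hk' => ?_
      simp only [Finset.mem_Icc] at hk hk'
      have : k = N := by omega
      rw [tent_eq_zero, Complex.ofReal_zero, zero_mul]
      subst this
      push_cast
      exact le_abs_self _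
    rw [← h3]
    refine Finset.sum_nbij' (fun k => k - 1) (fun k => k + 1) ?_ ?_ ?_ ?_ ?_
    · intro k hk
      simp only [Finset.mem_Icc] at hk ⊢
      omega
    · intro k hk
      simp only [Finset.mem_Icc] at hk ⊢
      omega
    · intro k _
      ring
    · intro k _
      ring
    · intro k _
      rw [sub_add_cancel]
  simp only [mul_sub, Finset.sum_sub_distrib, Complex.ofReal_sub, sub_mul, h1, h2]

theorem sum_norm_mul_le {a b : ℤ → ℂ} {M A : ℝ} (ha : Summable fun k => ‖a k‖ ^ 2)
    (haM : ∑' k, ‖a k‖ ^ 2 ≤ M) (hb : ∀ k, ‖b k‖ ^ 2 ≤ A) (s : Finset ℤ) :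
    ∑ k ∈ s, ‖a k‖ * ‖b k‖ ≤ √M * √(s.card * A) := by
  refine (Real.sum_mul_le_sqrt_mul_sqrt s _ _).trans ?_
  gcongr
  · exact (ha.sum_le_tsum s fun k _ => by positivity).trans haM
  · exact (Finset.sum_le_card_nsmul s _ A fun k _ => hb k).trans_eq (nsmul_eq_mul _ _)

/-- The pairing of an `ℓ²` solution of the discrete Schrödinger equation with a bounded solution of
the conjugate equation is conserved, as soon as it converges absolutely. -/
theorem tsum_mul_eq_of_isSolution {h : ℝ} {K : Set ℝ} (hK : Convex ℝ K) {f g : ℝ → ℤ → ℂ}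
    (hf : ∀ k, ∀ t ∈ K,
      HasDerivWithinAt (fun τ => f τ k) (Complex.I * discreteLaplacian h (f t) k) K t)
    (hg : ∀ k, ∀ t ∈ K,
      HasDerivWithinAt (fun τ => g τ k) (-Complex.I * discreteLaplacian h (g t) k) K t)
    {M A : ℝ} (hfM : ∀ t ∈ K, Summable (fun k => ‖f t k‖ ^ 2) ∧ ∑' k, ‖f t k‖ ^ 2 ≤ M)
    (hgA : ∀ t ∈ K, ∀ k, ‖g t k‖ ^ 2 ≤ A) {a b : ℝ} (ha : a ∈ K) (hb : b ∈ K)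
    (hsa : Summable fun k => f a k * g a k) (hsb : Summable fun k => f b k * g b k) :
    ∑' k, f b k * g b k = ∑' k, f a k * g a k := by
  set S : ℕ → ℝ → ℂ := fun N t =>
    ∑ k ∈ Finset.Icc (-N : ℤ) N, (tent N k : ℂ) * (f t k * g t k) with hS
  -- The discrete Wronskian is the flux of the pairing: the time derivative of f_k g_k is (i/h²)(d_k
  -- - d_{k-1}).
  set d : ℝ → ℤ → ℂ := fun t k => f t (k + 1) * g t k - f t k * g t (k + 1) with hd
  have hderiv : ∀ N, ∀ t ∈ K, HasDerivWithinAt (S N)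
      (Complex.I / (h : ℂ) ^ 2 *
        ∑ k ∈ Finset.Icc (-N - 1 : ℤ) N, ((tent N k - tent N (k + 1) : ℝ) : ℂ) * d t k) K t := by
    intro N t ht
    rw [← sum_tent_mul_sub, Finset.mul_sum]
    refine HasDerivWithinAt.fun_sum fun k _ => ?_
    refine (((hf k t ht).mul (hg k t ht)).const_mul (tent N k : ℂ)).congr_deriv ?_
    simp only [hd, discreteLaplacian, sub_add_cancel]
    ring
  -- The slope of the tent is at most 1/(N + 1), while Cauchy–Schwarz over 2N + 2 sites costs only
  -- O(√N). The derivative is O(1/√N) uniformly in t, so the mean value inequality finishes the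
  -- argument.
  have hbound : ∀ N : ℕ, ∀ t ∈ K, ‖Complex.I / (h : ℂ) ^ 2 *
      ∑ k ∈ Finset.Icc (-N - 1 : ℤ) N, ((tent N k - tent N (k + 1) : ℝ) : ℂ) * d t k‖ ≤
      1 / h ^ 2 * (1 / (N + 1) * (2 * (√M * √((2 * N + 2) * A)))) := by
    intro N t ht
    have hcard : ((Finset.Icc (-N - 1 : ℤ) N).card : ℝ) = 2 * N + 2 := by
      rw [Int.card_Icc]
      have : ((N : ℤ) + 1 - (-N - 1)).toNat = 2 * N + 2 := by omega
      rw [this]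
      push_cast
      ring
    obtain ⟨hs, hM⟩ := hfM t ht
    have hs' : Summable fun k => ‖f t (k + 1)‖ ^ 2 := (Equiv.addRight (1 : ℤ)).summable_iff.2 hs
    have hM' : ∑' k, ‖f t (k + 1)‖ ^ 2 ≤ M :=
      ((Equiv.addRight (1 : ℤ)).tsum_eq fun k => ‖f t k‖ ^ 2).trans_le hM
    have e1 := sum_norm_mul_le hs' hM' (hgA t ht) (Finset.Icc (-N - 1 : ℤ) N)
    have e2 := sum_norm_mul_le hs hM (fun k => hgA t ht (k + 1)) (Finset.Icc (-N - 1 : ℤ) N)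
    rw [hcard] at e1 e2
    rw [norm_mul, norm_div, Complex.norm_I, norm_pow, Complex.norm_real, Real.norm_eq_abs, sq_abs]
    refine mul_le_mul_of_nonneg_left ?_ (by positivity)
    calc ‖∑ k ∈ Finset.Icc (-N - 1 : ℤ) N, ((tent N k - tent N (k + 1) : ℝ) : ℂ) * d t k‖
        ≤ ∑ k ∈ Finset.Icc (-N - 1 : ℤ) N, 1 / ((N : ℝ) + 1) *
            (‖f t (k + 1)‖ * ‖g t k‖ + ‖f t k‖ * ‖g t (k + 1)‖) := by
          refine norm_sum_le_of_le _ fun k _ => ?_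
          rw [norm_mul, Complex.norm_real]
          refine mul_le_mul (abs_tent_sub_le N k) ?_ (norm_nonneg _) (by positivity)
          rw [← norm_mul, ← norm_mul]
          exact norm_sub_le _ _
      _ ≤ _ := by
          rw [← Finset.mul_sum, Finset.sum_add_distrib]
          refine mul_le_mul_of_nonneg_left ?_ (by positivity)
          linarith
  have hdiff : ∀ N, ‖S N b - S N a‖ ≤
      1 / h ^ 2 * (1 / (N + 1) * (2 * (√M * √((2 * N + 2) * A)))) * ‖b - a‖ := fun N =>
    hK.norm_image_sub_le_of_norm_hasDerivWithin_le (hderiv N) (hbound N) ha hb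
  have hlim : ∀ t, Summable (fun k => f t k * g t k) →
      Tendsto (fun N => S N t) atTop (𝓝 (∑' k, f t k * g t k)) := by
    intro t ht
    have e : ∀ N, S N t = ∑' k, (tent N k : ℂ) * (f t k * g t k) := by
      intro N
      refine (tsum_eq_sum fun k hk => ?_).symm
      rw [tent_eq_zero, Complex.ofReal_zero, zero_mul]
      have : (N + 1 : ℤ) ≤ |k| := by
        simp only [Finset.mem_Icc] at hk
        rw [le_abs]
        omega
      exact_mod_cast this
    simp only [e]
    refine tendsto_tsum_of_dominated_convergence ht.norm (fun k => ?_)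
      (Eventually.of_forall fun N k => ?_)
    · have := (Complex.continuous_ofReal.tendsto 1).comp (tendsto_tent k)
      simpa using this.mul_const (f t k * g t k)
    · rw [norm_mul, Complex.norm_real, Real.norm_of_nonneg (tent_nonneg N k)]
      exact mul_le_of_le_one_left (norm_nonneg _) (tent_le_one N k)
  have hzero : Tendsto (fun N : ℕ =>
      1 / h ^ 2 * (1 / ((N : ℝ) + 1) * (2 * (√M * √((2 * N + 2) * A)))) * ‖b - a‖) atTop (𝓝 0) := by
    have hN : Tendsto (fun N : ℕ => √((N : ℝ) + 1)) atTop atTop :=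
      Real.tendsto_sqrt_atTop.comp
        (tendsto_atTop_add_const_right _ _ tendsto_natCast_atTop_atTop)
    have := (tendsto_const_nhds (x := 1 / h ^ 2 * (2 * (√M * √(2 * A))) * ‖b - a‖)).div_atTop hN
    refine this.congr fun N => ?_
    have hp : (0 : ℝ) < N + 1 := by positivity
    rw [show (2 * (N : ℝ) + 2) * A = (N + 1) * (2 * A) by ring, Real.sqrt_mul hp.le]
    have hq : √((N : ℝ) + 1) ≠ 0 := (Real.sqrt_pos.2 hp).ne'
    have hr : 1 / ((N : ℝ) + 1) = 1 / (√((N : ℝ) + 1) * √((N : ℝ) + 1)) := by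
      rw [Real.mul_self_sqrt hp.le]
    rw [hr]
    field_simp
  have hsub := ((hlim b hsb).sub (hlim a hsa)).norm
  have := le_of_tendsto_of_tendsto' hsub hzero hdiff
  exact sub_eq_zero.1 (norm_le_zero_iff.1 this)

variable {h : ℝ} {J : Set ℝ} {f : ℝ → ℤ → ℂ}

/-- The complex conjugate of f solves the conjugate equation and is bounded by its ℓ² norm, so it
may be paired with f. -/
theorem IsDiscreteSchrodingerSolution.tsum_norm_sq_eq (hf : IsDiscreteSchrodingerSolution h J f)
    (hJ : J.OrdConnected) {a b : ℝ} (ha : a ∈ J) (hb : b ∈ J) :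
    ∑' k, ‖f b k‖ ^ 2 = ∑' k, ‖f a k‖ ^ 2 := by
  have hsub : Set.uIcc a b ⊆ J := hJ.uIcc_subset ha hb
  obtain ⟨M, hM⟩ := hf.l2_bounded _ hsub isCompact_uIcc
  have hconj : ∀ t k, f t k * star (f t k) = ((‖f t k‖ ^ 2 : ℝ) : ℂ) := by
    intro t k
    rw [← starRingEnd_apply, Complex.mul_conj, Complex.normSq_eq_norm_sq]
  have key := tsum_mul_eq_of_isSolution (h := h) (convex_uIcc a b) (f := f)
    (g := fun t k => star (f t k)) (A := M)
    (fun k t ht => (hf.hasDeriv k t (hsub ht)).mono hsub) (fun k t ht => ?_) hM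
    (fun t ht k => ?_) Set.left_mem_uIcc Set.right_mem_uIcc ?_ ?_
  · simp only [hconj, ← Complex.ofReal_tsum] at key
    exact_mod_cast key
  · refine (((hf.hasDeriv k t (hsub ht)).mono hsub).star).congr_deriv ?_
    simp [discreteLaplacian]
  · rw [norm_star]
    exact ((hM t ht).1.le_tsum k fun j _ => by positivity).trans (hM t ht).2
  · simp only [hconj]
    exact Complex.summable_ofReal.2 (hM a Set.left_mem_uIcc).1
  · simp only [hconj]
    exact Complex.summable_ofReal.2 (hM b Set.right_mem_uIcc).1

/-- The Fourier multiplier of the discrete Schrödinger group, for data with absolutely convergent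
Fourier series. -/
theorem IsDiscreteSchrodingerSolution.fourier_eq (hf : IsDiscreteSchrodingerSolution h J f)
    (hJ : J.OrdConnected) (h0 : (0 : ℝ) ∈ J) (h1 : (1 : ℝ) ∈ J) (hs0 : Summable fun k => ‖f 0 k‖)
    (hs1 : Summable fun k => ‖f 1 k‖) (θ : ℝ) :
    ∑' k : ℤ, f 1 k * Complex.exp (Complex.I * k * θ) =
      Complex.exp (-Complex.I * (2 - 2 * Complex.cos θ) / h ^ 2) *
        ∑' k : ℤ, f 0 k * Complex.exp (Complex.I * k * θ) := by
  have hsub : Set.uIcc (0 : ℝ) 1 ⊆ J := hJ.uIcc_subset h0 h1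
  obtain ⟨M, hM⟩ := hf.l2_bounded _ hsub isCompact_uIcc
  set c : ℂ := Complex.I * (2 - 2 * Complex.cos θ) / h ^ 2 with hc
  have hcI : c = (((2 - 2 * Real.cos θ) / h ^ 2 : ℝ) : ℂ) * Complex.I := by
    rw [hc]; push_cast; ring
  -- This plane wave solves the conjugate equation, since exp(ikθ) is an eigenfunction of the
  -- discrete Laplacian with eigenvalue (2cos θ - 2)/h². It has modulus one because c is purely
  -- imaginary.
  set g : ℝ → ℤ → ℂ := fun t k => Complex.exp (Complex.I * k * θ) * Complex.exp (c * t) with hg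
  have hnorm1 : ∀ k : ℤ, ‖Complex.exp (Complex.I * k * θ)‖ = 1 := by
    intro k
    rw [show Complex.I * k * θ = ((k * θ : ℝ) : ℂ) * Complex.I by push_cast; ring,
      Complex.norm_exp_ofReal_mul_I]
  have hnorm : ∀ t k, ‖g t k‖ = 1 := by
    intro t k
    rw [hg, norm_mul, hnorm1, hcI,
      show ((((2 - 2 * Real.cos θ) / h ^ 2 : ℝ) : ℂ) * Complex.I) * t =
        (((2 - 2 * Real.cos θ) / h ^ 2 * t : ℝ) : ℂ) * Complex.I by push_cast; ring,
      Complex.norm_exp_ofReal_mul_I, one_mul]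
  have hsum : ∀ t, Summable (fun k => ‖f t k‖) → Summable fun k => f t k * g t k := by
    intro t ht
    refine Summable.of_norm (ht.congr fun k => ?_)
    rw [norm_mul, hnorm, mul_one]
  have key := tsum_mul_eq_of_isSolution (h := h) (convex_uIcc 0 1) (f := f) (g := g) (A := 1)
    (fun k t ht => (hf.hasDeriv k t (hsub ht)).mono hsub) (fun k t ht => ?_) hM
    (fun t ht k => by rw [hnorm, one_pow]) Set.left_mem_uIcc Set.right_mem_uIcc (hsum 0 hs0)
    (hsum 1 hs1)
  · simp only [hg, ← mul_assoc, tsum_mul_right] at key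
    rw [Complex.ofReal_zero, mul_zero, Complex.exp_zero, mul_one, Complex.ofReal_one, mul_one] at key
    rw [← key, show -Complex.I * (2 - 2 * Complex.cos θ) / h ^ 2 = -c by rw [hc]; ring,
      mul_comm, mul_assoc, ← Complex.exp_add]
    simp
  · have hd : HasDerivAt (fun τ : ℝ => Complex.exp (c * τ)) (Complex.exp (c * t) * c) t := by
      have := (((hasDerivAt_id t).ofReal_comp).const_mul c).cexp
      simpa using this
    refine ((hd.const_mul (Complex.exp (Complex.I * k * θ))).hasDerivWithinAt).congr_deriv ?_
    have e1 : Complex.exp (Complex.I * (k + 1 : ℤ) * θ) =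
        Complex.exp (Complex.I * k * θ) * Complex.exp (θ * Complex.I) := by
      rw [← Complex.exp_add]; push_cast; ring_nf
    have e2 : Complex.exp (Complex.I * (k - 1 : ℤ) * θ) =
        Complex.exp (Complex.I * k * θ) * Complex.exp (-θ * Complex.I) := by
      rw [← Complex.exp_add]; push_cast; ring_nf
    simp only [hg, discreteLaplacian, e1, e2, hc, Complex.cos]
    ring

/-! ### Mesh sums as integrals of step functions, and entire Fourier series -/

theorem integrable_exp_neg_abs : Integrable (fun x : ℝ => Real.exp (-|x|)) := by
  rw [← integrableOn_univ, ← Set.Iic_union_Ioi (a := (0 : ℝ))]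
  refine IntegrableOn.union ?_ ?_
  · refine (integrableOn_exp_Iic 0).congr_fun (fun x hx => ?_) measurableSet_Iic
    simp only [abs_of_nonpos (Set.mem_Iic.1 hx), neg_neg]
  · refine (integrableOn_exp_neg_Ioi 0).congr_fun (fun x hx => ?_) measurableSet_Ioi
    simp only [abs_of_pos (Set.mem_Ioi.1 hx)]

theorem abs_floor_div_mul_sub_le {h : ℝ} (hh : 0 < h) (x : ℝ) :
    |(⌊x / h⌋ : ℝ) * h - x| ≤ h := by
  have h1 := Int.floor_le (x / h)
  have h2 := Int.lt_floor_add_one (x / h)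
  rw [le_div_iff₀ hh] at h1
  rw [div_lt_iff₀ hh] at h2
  rw [abs_le]
  constructor <;> linarith

/-- Provides the integrable majorant of the step functions, uniform in small h, that dominated
convergence needs. -/
theorem exp_neg_abs_floor_le {h : ℝ} (hh : 0 < h) (x : ℝ) :
    Real.exp (-(|(⌊x / h⌋ : ℝ)| * h)) ≤ Real.exp h * Real.exp (-|x|) := by
  rw [← Real.exp_add]
  refine Real.exp_le_exp.2 ?_
  have h1 := abs_floor_div_mul_sub_le hh x
  have h2 := abs_sub_abs_le_abs_sub x ((⌊x / h⌋ : ℝ) * h)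
  rw [abs_sub_comm, abs_mul, abs_of_pos hh] at h2
  linarith

theorem stronglyMeasurable_comp_floor (F : ℤ → ℂ) (h : ℝ) :
    StronglyMeasurable fun x : ℝ => F ⌊x / h⌋ :=
  ((measurable_from_top (f := F)).comp
    (Int.measurable_floor.comp (measurable_id.div_const h))).stronglyMeasurable

theorem integrable_comp_floor {F : ℤ → ℂ} {h K : ℝ} (hh : 0 < h)
    (hF : ∀ k : ℤ, ‖F k‖ ≤ K * Real.exp (-(|(k : ℝ)| * h))) :
    Integrable fun x : ℝ => F ⌊x / h⌋ := by
  have hK : 0 ≤ K := by simpa using (norm_nonneg _).trans (hF 0)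
  refine (integrable_exp_neg_abs.const_mul (K * Real.exp h)).mono'
    (stronglyMeasurable_comp_floor F h).aestronglyMeasurable (Eventually.of_forall fun x => ?_)
  rw [mul_assoc]
  exact (hF _).trans (mul_le_mul_of_nonneg_left (exp_neg_abs_floor_le hh x) hK)

/-- A sum over the mesh as the integral of a step function. -/
theorem hasSum_integral_comp_floor {F : ℤ → ℂ} {h K : ℝ} (hh : 0 < h)
    (hF : ∀ k : ℤ, ‖F k‖ ≤ K * Real.exp (-(|(k : ℝ)| * h))) :
    HasSum (fun k => (h : ℂ) * F k) (∫ x : ℝ, F ⌊x / h⌋) := by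
  have hint : Integrable fun y : ℝ => F ⌊y⌋ := by
    have := (integrable_comp_floor hh hF).comp_mul_right' hh.ne'
    simpa [mul_div_cancel_right₀ _ hh.ne'] using this
  have hs := hasSum_integral_iUnion (fun n : ℤ => measurableSet_Ico)
    (Set.pairwise_disjoint_Ico_intCast ℝ) (hint.integrableOn)
  rw [iUnion_Ico_intCast, setIntegral_univ] at hs
  have e : ∀ n : ℤ, ∫ y in Set.Ico (n : ℝ) (n + 1), F ⌊y⌋ = F n := by
    intro n
    rw [setIntegral_congr_fun (g := fun _ => F n) measurableSet_Ico fun y hy => ?_]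
    · simp
    · simp only [Int.floor_eq_on_Ico n y hy]
  simp only [e] at hs
  have h2 := Measure.integral_comp_div (fun y : ℝ => F ⌊y⌋) h
  rw [h2, abs_of_pos hh, Complex.real_smul]
  exact hs.mul_left _

theorem norm_integral_comp_floor_le {F : ℤ → ℂ} {h K : ℝ} (hh : 0 < h)
    (hF : ∀ k : ℤ, ‖F k‖ ≤ K * Real.exp (-(|(k : ℝ)| * h))) :
    ‖∫ x : ℝ, F ⌊x / h⌋‖ ≤ K * Real.exp h * ∫ x : ℝ, Real.exp (-|x|) := by
  have hK : 0 ≤ K := by simpa using (norm_nonneg _).trans (hF 0)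
  rw [← integral_const_mul]
  refine norm_integral_le_of_norm_le (integrable_exp_neg_abs.const_mul _)
    (Eventually.of_forall fun x => ?_)
  rw [mul_assoc]
  exact (hF _).trans (mul_le_mul_of_nonneg_left (exp_neg_abs_floor_le hh x) hK)

theorem norm_exp_I_mul_le (k : ℝ) (z : ℂ) :
    ‖Complex.exp (Complex.I * k * z)‖ ≤ Real.exp (|k| * |z.im|) := by
  rw [Complex.norm_exp]
  refine Real.exp_le_exp.2 ?_
  have : (Complex.I * k * z).re = -(k * z.im) := by simp
  rw [this, ← abs_mul]
  exact neg_le_abs _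

/-- The decay rate R pays |Im z| for the growth of the exponential off the real axis and keeps r for
summability. -/
theorem norm_mul_exp_I_mul_le {a : ℂ} {K k r R : ℝ} (hr : 0 ≤ K)
    (ha : ‖a‖ ≤ K * Real.exp (-(|k| * R))) {z : ℂ} (hz : |z.im| + r ≤ R) :
    ‖a * Complex.exp (Complex.I * k * z)‖ ≤ K * Real.exp (-(|k| * r)) := by
  rw [norm_mul]
  refine (mul_le_mul ha (norm_exp_I_mul_le k z) (norm_nonneg _) (by positivity)).trans ?_
  rw [mul_assoc, ← Real.exp_add]
  refine mul_le_mul_of_nonneg_left (Real.exp_le_exp.2 ?_) hr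
  nlinarith [mul_le_mul_of_nonneg_left hz (abs_nonneg k)]

theorem summable_exp_neg_abs_int : Summable fun k : ℤ => Real.exp (-|(k : ℝ)|) := by
  have h := hasSum_integral_comp_floor (F := fun k : ℤ => ((Real.exp (-|(k : ℝ)|) : ℝ) : ℂ))
    (h := 1) (K := 1) one_pos fun k => by
      rw [Complex.norm_real, Real.norm_of_nonneg (Real.exp_pos _).le, one_mul, mul_one]
  have h2 := h.summable
  simp only [Complex.ofReal_one, one_mul] at h2
  exact Complex.summable_ofReal.1 h2

/-- A Fourier series with superexponentially decaying coefficients is an entire function. -/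
theorem differentiable_fourierSeries {a : ℤ → ℂ}
    (ha : ∀ R : ℝ, ∃ K : ℝ, ∀ k : ℤ, ‖a k‖ ≤ K * Real.exp (-(|(k : ℝ)| * R))) :
    Differentiable ℂ fun w : ℂ => ∑' k : ℤ, a k * Complex.exp (Complex.I * k * w) := by
  intro w
  set R := |w.im| + 1 with hR
  obtain ⟨K, hK⟩ := ha (R + 1)
  have hK0 : 0 ≤ K := by simpa using (norm_nonneg _).trans (hK 0)
  have hopen : IsOpen {z : ℂ | |z.im| < R} :=
    isOpen_lt (continuous_abs.comp Complex.continuous_im) continuous_const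
  have hd := Complex.differentiableOn_tsum_of_summable_norm
    (F := fun (k : ℤ) (w : ℂ) => a k * Complex.exp (Complex.I * k * w))
    (summable_exp_neg_abs_int.mul_left K) (fun k => Differentiable.differentiableOn (by fun_prop))
    hopen (fun k z hz => ?_)
  · exact hd.differentiableAt (hopen.mem_nhds (by simp [hR]))
  · have := norm_mul_exp_I_mul_le (r := 1) hK0 (hK k) (z := z)
      (by have : |z.im| < R := hz; linarith)
    simpa using this

/-- Serves to continue the multiplier relation from real to complex frequencies. -/
theorem eq_of_eq_on_real {f g : ℂ → ℂ} (hf : Differentiable ℂ f) (hg : Differentiable ℂ g)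
    (h : ∀ x : ℝ, f x = g x) (z : ℂ) : f z = g z := by
  have hfa := hf.differentiableOn.analyticOnNhd isOpen_univ
  have hga := hg.differentiableOn.analyticOnNhd isOpen_univ
  refine congrFun (hfa.eq_of_frequently_eq (z₀ := 0) hga ?_) z
  have ht : Tendsto (fun x : ℝ => (x : ℂ)) (𝓝[≠] 0) (𝓝[≠] 0) := by
    refine tendsto_nhdsWithin_iff.2 ⟨?_, ?_⟩
    · exact (Complex.continuous_ofReal.tendsto' 0 0 Complex.ofReal_zero).mono_left
        nhdsWithin_le_nhds
    · filter_upwards [self_mem_nhdsWithin] with x hx using Complex.ofReal_ne_zero.2 hx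
  exact ht.frequently (Eventually.frequently (Eventually.of_forall h))

/-- Here cosh(hη) - 1 = 2 sinh²(hη/2), and sinh(hη/2)/h is a difference quotient at 0. This is where
the Bessel weight turns Gaussian. -/
theorem tendsto_cosh_sub_one_div_sq (γ η : ℝ) :
    Tendsto (fun h : ℝ => γ / h ^ 2 * (Real.cosh (h * η) - 1)) (𝓝[>] 0) (𝓝 (γ * η ^ 2 / 2)) := by
  have hd : HasDerivAt (fun h : ℝ => Real.sinh (h * (η / 2))) (η / 2) 0 := by
    have := ((hasDerivAt_id (0 : ℝ)).mul_const (η / 2)).sinh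
    simpa using this
  have ht := (hd.tendsto_slope_zero.mono_left
    (nhdsWithin_mono 0 (show Set.Ioi (0 : ℝ) ⊆ {0}ᶜ from fun x hx => (Set.mem_Ioi.1 hx).ne')))
  have h2 := (ht.pow 2).const_mul (2 * γ)
  convert h2 using 1
  · funext h
    have e : Real.cosh (h * η) = 1 + 2 * Real.sinh (h * (η / 2)) ^ 2 := by
      rw [show h * η = 2 * (h * (η / 2)) by ring, Real.cosh_two_mul, Real.cosh_sq]
      ring
    rw [e]
    simp only [zero_add, zero_mul, Real.sinh_zero, sub_zero, smul_eq_mul]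
    ring
  · congr 1
    ring

theorem tendsto_two_sub_cos_div_sq (z : ℂ) :
    Tendsto (fun h : ℝ => (2 - 2 * Complex.cos (h * z)) / (h : ℂ) ^ 2) (𝓝[>] 0) (𝓝 (z ^ 2)) := by
  have hd : HasDerivAt (fun h : ℝ => Complex.sin (h * (z / 2))) (z / 2) 0 := by
    have := (((hasDerivAt_id ((0 : ℝ) : ℂ)).mul_const (z / 2)).csin).comp_ofReal
    simpa using this
  have ht := (hd.tendsto_slope_zero.mono_left
    (nhdsWithin_mono 0 (show Set.Ioi (0 : ℝ) ⊆ {0}ᶜ from fun x hx => (Set.mem_Ioi.1 hx).ne')))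
  have h2 := (ht.pow 2).const_mul 4
  convert h2 using 1
  · funext h
    have e : Complex.cos (h * z) = 1 - 2 * Complex.sin (h * (z / 2)) ^ 2 := by
      rw [show (h : ℂ) * z = 2 * (h * (z / 2)) by ring, Complex.cos_two_mul, Complex.cos_sq']
      ring
    rw [e]
    simp only [zero_add, Complex.ofReal_zero, zero_mul, Complex.sin_zero, sub_zero,
      Complex.real_smul, Complex.ofReal_inv]
    ring
  · congr 1
    ring

/-! ### The Fourier–Laplace transform of the limit -/

section FourierLaplace

variable {u : ℝ → ℂ}

theorem integrable_mul_exp_I_mul (hu : Continuous u)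
    (hdecay : ∀ R : ℝ, ∃ K : ℝ, ∀ x : ℝ, ‖u x‖ ≤ K * Real.exp (-(|x| * R))) (z : ℂ) :
    Integrable fun x : ℝ => u x * Complex.exp (Complex.I * x * z) := by
  obtain ⟨K, hK⟩ := hdecay (|z.im| + 1)
  have hK0 : 0 ≤ K := by simpa using (norm_nonneg _).trans (hK 0)
  refine (integrable_exp_neg_abs.const_mul K).mono'
    (by fun_prop : Continuous _).aestronglyMeasurable (Eventually.of_forall fun x => ?_)
  simpa using norm_mul_exp_I_mul_le (r := 1) hK0 (hK x) (z := z) le_rfl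

/-- The Fourier–Laplace transform of a superexponentially decaying function is entire. -/
theorem differentiable_fourierLaplace (hu : Continuous u)
    (hdecay : ∀ R : ℝ, ∃ K : ℝ, ∀ x : ℝ, ‖u x‖ ≤ K * Real.exp (-(|x| * R))) :
    Differentiable ℂ fun z : ℂ => ∫ x : ℝ, u x * Complex.exp (Complex.I * x * z) := by
  intro w
  obtain ⟨K, hK⟩ := hdecay (|w.im| + 3)
  have hK0 : 0 ≤ K := by simpa using (norm_nonneg _).trans (hK 0)
  refine (hasDerivAt_integral_of_dominated_loc_of_deriv_le
    (F := fun (z : ℂ) (x : ℝ) => u x * Complex.exp (Complex.I * x * z))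
    (F' := fun z x => u x * (Complex.exp (Complex.I * x * z) * (Complex.I * x)))
    (bound := fun x => K * Real.exp (-|x|)) (Metric.ball_mem_nhds w one_pos)
    (Eventually.of_forall fun z => (by fun_prop : Continuous _).aestronglyMeasurable)
    (integrable_mul_exp_I_mul hu hdecay w) (by fun_prop : Continuous _).aestronglyMeasurable
    (Eventually.of_forall fun x z hz => ?_) (integrable_exp_neg_abs.const_mul K)
    (Eventually.of_forall fun x z _ => ?_)).2.differentiableAt
  · have him : |z.im| + 2 ≤ |w.im| + 3 := by
      have h1 : |(z - w).im| ≤ 1 := (Complex.abs_im_le_norm _).trans (mem_ball_iff_norm.1 hz).le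
      have h2 := abs_sub_abs_le_abs_sub z.im w.im
      rw [Complex.sub_im] at h1
      linarith
    have h1 := norm_mul_exp_I_mul_le hK0 (hK x) (z := z) him
    have h2 : |x| ≤ Real.exp |x| := by linarith [Real.add_one_le_exp |x|]
    rw [← mul_assoc, norm_mul, norm_mul Complex.I, Complex.norm_I, one_mul, Complex.norm_real,
      Real.norm_eq_abs]
    refine (mul_le_mul h1 h2 (abs_nonneg _) (by positivity)).trans_eq ?_
    rw [mul_assoc, ← Real.exp_add]
    ring_nf
  · have := ((hasDerivAt_id z).const_mul (Complex.I * x)).cexp.const_mul (u x)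
    simpa using this

/-- At real z the integral is the Fourier transform at -z/(2π), so Fourier inversion for a
continuous integrable function applies. -/
theorem eq_zero_of_fourierLaplace_eq_zero (hu : Continuous u)
    (hdecay : ∀ R : ℝ, ∃ K : ℝ, ∀ x : ℝ, ‖u x‖ ≤ K * Real.exp (-(|x| * R)))
    (h : ∀ z : ℂ, ∫ x : ℝ, u x * Complex.exp (Complex.I * x * z) = 0) (x : ℝ) : u x = 0 := by
  have hint : Integrable u := by simpa using integrable_mul_exp_I_mul hu hdecay 0
  have hF : FourierTransform.fourier u = 0 := by
    funext ξ
    rw [Real.fourier_real_eq_integral_exp_smul, Pi.zero_apply,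
      ← h ((-2 * Real.pi * ξ : ℝ) : ℂ)]
    refine integral_congr_ae (Eventually.of_forall fun v => ?_)
    simp only [smul_eq_mul]
    rw [mul_comm]
    congr 2
    push_cast
    ring
  have hinv := hu.fourierInv_fourier_eq hint (by rw [hF]; exact integrable_zero _ _ _)
  rw [← congrFun hinv x, hF, Real.fourierInv_eq]
  simp

end FourierLaplace

/-! ### Passage to the limit in the mesh size -/

section Limit

/-- The bound provided by `besselI_div_le` for a sequence dominated by normalised Bessel
functions of argument `γ / h ^ 2`. -/
def BesselDecay (C γ h : ℝ) (a : ℤ → ℂ) : Prop :=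
  ∀ (k : ℤ) (η : ℝ), ‖a k‖ ≤
    C * Real.exp (γ / h ^ 2 * (Real.cosh (h * η) - 1)) * Real.exp (-(|(k : ℝ)| * h * η))

variable {C γ h : ℝ} {a : ℤ → ℂ}

theorem BesselDecay.nonneg (ha : BesselDecay C γ h a) : 0 ≤ C := by
  have := (norm_nonneg _).trans (ha 0 0)
  simpa using this

theorem BesselDecay.exists_bound (hh : 0 < h) (ha : BesselDecay C γ h a) (R : ℝ) :
    ∃ K : ℝ, ∀ k : ℤ, ‖a k‖ ≤ K * Real.exp (-(|(k : ℝ)| * R)) := by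
  refine ⟨C * Real.exp (γ / h ^ 2 * (Real.cosh (h * (R / h)) - 1)),
    fun k => (ha k (R / h)).trans_eq ?_⟩
  rw [mul_assoc |(k : ℝ)|, mul_div_cancel₀ _ hh.ne']

/-- The choice η = |Im z| + 1 compensates the exponential and leaves exp(-|k|h), whose sum times h
stays bounded as h → 0. Hence the |Im z| + 1 in `eq_zero_of_hardy`. -/
theorem BesselDecay.norm_mul_exp_le (hh : 0 < h) (ha : BesselDecay C γ h a) (z : ℂ) (k : ℤ) :
    ‖a k * Complex.exp (Complex.I * k * (h * z))‖ ≤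
      C * Real.exp (γ / h ^ 2 * (Real.cosh (h * (|z.im| + 1)) - 1)) *
        Real.exp (-(|(k : ℝ)| * h)) := by
  have hC := ha.nonneg
  refine norm_mul_exp_I_mul_le (R := h * (|z.im| + 1)) (by positivity)
    ((ha k _).trans_eq (by rw [mul_assoc |(k : ℝ)|])) ?_
  rw [Complex.im_ofReal_mul, abs_mul, abs_of_pos hh]
  linarith

theorem BesselDecay.mul_tsum_eq (hh : 0 < h) (ha : BesselDecay C γ h a) (z : ℂ) :
    (h : ℂ) * ∑' k : ℤ, a k * Complex.exp (Complex.I * k * (h * z)) =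
      ∫ x : ℝ, a ⌊x / h⌋ * Complex.exp (Complex.I * ⌊x / h⌋ * (h * z)) := by
  rw [← tsum_mul_left]
  exact (hasSum_integral_comp_floor hh (ha.norm_mul_exp_le hh z)).tsum_eq

theorem BesselDecay.norm_mul_tsum_le (hh : 0 < h) (ha : BesselDecay C γ h a) (z : ℂ) :
    ‖(h : ℂ) * ∑' k : ℤ, a k * Complex.exp (Complex.I * k * (h * z))‖ ≤
      C * Real.exp (γ / h ^ 2 * (Real.cosh (h * (|z.im| + 1)) - 1)) * Real.exp h *
        ∫ x : ℝ, Real.exp (-|x|) := by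
  rw [ha.mul_tsum_eq hh]
  exact norm_integral_comp_floor_le hh (ha.norm_mul_exp_le hh z)

theorem tendsto_besselDecay_const (C γ η E : ℝ) :
    Tendsto (fun h : ℝ => C * Real.exp (γ / h ^ 2 * (Real.cosh (h * η) - 1)) * Real.exp h * E)
      (𝓝[>] 0) (𝓝 (C * E * Real.exp (γ * η ^ 2 / 2))) := by
  have h1 := (Real.continuous_exp.tendsto _).comp (tendsto_cosh_sub_one_div_sq γ η)
  have h2 : Tendsto Real.exp (𝓝[>] 0) (𝓝 1) :=
    (Real.continuous_exp.tendsto' 0 1 Real.exp_zero).mono_left nhdsWithin_le_nhds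
  have := ((h1.const_mul C).mul h2).mul_const E
  rwa [mul_one, mul_right_comm] at this

theorem tendsto_floor_div_mul (x : ℝ) :
    Tendsto (fun h : ℝ => (⌊x / h⌋ : ℝ) * h) (𝓝[>] 0) (𝓝 x) := by
  rw [tendsto_iff_norm_sub_tendsto_zero]
  refine squeeze_zero' (Eventually.of_forall fun _ => norm_nonneg _) ?_
    (tendsto_id.mono_left nhdsWithin_le_nhds)
  filter_upwards [self_mem_nhdsWithin] with h hh using abs_floor_div_mul_sub_le hh x

/-- A mesh limit `u` of sequences with Bessel decay at two times, related by the discrete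
Schrödinger multiplier, vanishes if the decay is subcritical. -/
theorem eq_zero_of_mesh_limit {u : ℝ → ℂ} (hu : Continuous u) {a b : ℝ → ℤ → ℂ} {α β : ℝ}
    (hα : 0 ≤ α) (hβ : 0 ≤ β) (hαβ : α * β < 4)
    (ha : ∀ h, 0 < h → BesselDecay C α h (a h)) (hb : ∀ h, 0 < h → BesselDecay C β h (b h))
    (hab : ∀ h, 0 < h → ∀ θ : ℝ, ∑' k : ℤ, b h k * Complex.exp (Complex.I * k * θ) =
      Complex.exp (-Complex.I * (2 - 2 * Complex.cos θ) / h ^ 2) *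
        ∑' k : ℤ, a h k * Complex.exp (Complex.I * k * θ))
    (hlim : ∀ x, Tendsto (fun h => a h ⌊x / h⌋) (𝓝[>] 0) (𝓝 (u x))) (x : ℝ) : u x = 0 := by
  have hC : 0 ≤ C := (ha 1 one_pos).nonneg
  have hab' : ∀ h, 0 < h → ∀ w : ℂ, ∑' k : ℤ, b h k * Complex.exp (Complex.I * k * w) =
      Complex.exp (-Complex.I * (2 - 2 * Complex.cos w) / h ^ 2) *
        ∑' k : ℤ, a h k * Complex.exp (Complex.I * k * w) := by
    intro h hh
    refine eq_of_eq_on_real (differentiable_fourierSeries ((hb h hh).exists_bound hh))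
      (Differentiable.mul (by fun_prop) (differentiable_fourierSeries ((ha h hh).exists_bound hh)))
      fun x => hab h hh x
  -- For fixed R, let h → 0 in the Bessel decay at the site ⌊x/h⌋ with η = R.
  have hdecay : ∀ R : ℝ, ∃ K : ℝ, ∀ x : ℝ, ‖u x‖ ≤ K * Real.exp (-(|x| * R)) := by
    intro R
    refine ⟨C * Real.exp (α * R ^ 2 / 2), fun x => ?_⟩
    have h1 := ((Real.continuous_exp.tendsto _).comp (tendsto_cosh_sub_one_div_sq α R)).const_mul C
    have h2 := (Real.continuous_exp.tendsto _).comp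
      (((tendsto_floor_div_mul x).abs.mul_const R).neg)
    refine le_of_tendsto_of_tendsto (hlim x).norm (h1.mul h2) ?_
    filter_upwards [self_mem_nhdsWithin] with h hh
    have := ha h hh ⌊x / h⌋ R
    simpa [abs_mul, abs_of_pos (Set.mem_Ioi.1 hh)] using this
  set G : ℂ → ℂ := fun z => ∫ x : ℝ, u x * Complex.exp (Complex.I * x * z) with hG
  have hconv : ∀ z : ℂ, Tendsto (fun h : ℝ => (h : ℂ) *
      ∑' k : ℤ, a h k * Complex.exp (Complex.I * k * (h * z))) (𝓝[>] 0) (𝓝 (G z)) := by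
    intro z
    have hI : Tendsto (fun h : ℝ => ∫ x : ℝ,
        a h ⌊x / h⌋ * Complex.exp (Complex.I * ⌊x / h⌋ * (h * z))) (𝓝[>] 0) (𝓝 (G z)) := by
      have hev := (tendsto_besselDecay_const C α (|z.im| + 1) 1).eventually_lt_const
        (lt_add_one (C * 1 * Real.exp (α * (|z.im| + 1) ^ 2 / 2)))
      refine tendsto_integral_filter_of_dominated_convergence
        (fun x => (C * 1 * Real.exp (α * (|z.im| + 1) ^ 2 / 2) + 1) * Real.exp (-|x|))
        (Eventually.of_forall fun h => ?_) ?_ (integrable_exp_neg_abs.const_mul _)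
        (Eventually.of_forall fun x => ?_)
      · exact (stronglyMeasurable_comp_floor
          (fun k => a h k * Complex.exp (Complex.I * k * (h * z))) h).aestronglyMeasurable
      · filter_upwards [self_mem_nhdsWithin, hev] with h hh hlt
        refine Eventually.of_forall fun x => ?_
        refine ((ha h hh).norm_mul_exp_le hh z _).trans ?_
        refine (mul_le_mul_of_nonneg_left (exp_neg_abs_floor_le hh x) (by positivity)).trans ?_
        rw [← mul_assoc]
        rw [mul_one] at hlt
        exact mul_le_mul_of_nonneg_right hlt.le (Real.exp_pos _).le
      · have h1 := (Complex.continuous_ofReal.tendsto _).comp (tendsto_floor_div_mul x)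
        have h2 := (Complex.continuous_exp.tendsto _).comp
          ((h1.const_mul Complex.I).mul_const z)
        refine ((hlim x).mul h2).congr fun h => ?_
        simp only [Function.comp_apply, Complex.ofReal_mul, Complex.ofReal_intCast]
        ring_nf
    refine hI.congr' ?_
    filter_upwards [self_mem_nhdsWithin] with h hh using ((ha h hh).mul_tsum_eq hh z).symm
  have hE : 0 ≤ ∫ x : ℝ, Real.exp (-|x|) := integral_nonneg fun x => (Real.exp_pos _).le
  refine eq_zero_of_fourierLaplace_eq_zero hu hdecay (fun z => eq_zero_of_hardy (G := G)
    (differentiable_fourierLaplace hu hdecay) hα hβ hαβ (mul_nonneg hC hE) (fun z => ?_)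
    (fun z => ?_) z) x
  · refine le_of_tendsto_of_tendsto (hconv z).norm
      (tendsto_besselDecay_const C α (|z.im| + 1) (∫ x : ℝ, Real.exp (-|x|))) ?_
    filter_upwards [self_mem_nhdsWithin] with h hh using (ha h hh).norm_mul_tsum_le hh z
  -- No limit of the sequences b h is assumed: the multiplier relation expresses their transforms
  -- through those of a h, which converge.
  · have h1 := (Complex.continuous_exp.tendsto _).comp
      ((tendsto_two_sub_cos_div_sq z).const_mul (-Complex.I))
    refine le_of_tendsto_of_tendsto (h1.mul (hconv z)).norm
      (tendsto_besselDecay_const C β (|z.im| + 1) (∫ x : ℝ, Real.exp (-|x|))) ?_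
    filter_upwards [self_mem_nhdsWithin] with h hh
    refine le_of_eq_of_le ?_ ((hb h hh).norm_mul_tsum_le hh z)
    rw [hab' h hh, Function.comp_apply, mul_div_assoc]
    congr 1
    ring

end Limit

/-! ### From the Bessel hypotheses to the theorem -/

theorem besselDecay_of_le {C γ h : ℝ} {a : ℤ → ℂ} (hγ : 0 ≤ γ)
    (ha : ∀ k : ℤ, ‖a k‖ ≤ C * (besselI k (γ / h ^ 2) / besselI 0 (γ / h ^ 2))) :
    BesselDecay C γ h a := by
  have hC : 0 ≤ C := by
    have := (norm_nonneg _).trans (ha 0)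
    rwa [div_self (besselI_zero_pos _).ne', mul_one] at this
  intro k η
  refine (ha k).trans ?_
  rw [mul_assoc, ← Real.exp_add]
  refine mul_le_mul_of_nonneg_left
    ((besselI_div_le k (η := h * η) (by positivity)).trans_eq ?_) hC
  congr 1
  ring

/-- A bound by normalised Bessel functions of negative argument is only satisfied by zero. -/
theorem eq_zero_of_le_besselI_neg {C γ h : ℝ} {a : ℤ → ℂ} (hγ : γ < 0) (hh : 0 < h)
    (ha : ∀ k : ℤ, ‖a k‖ ≤ C * (besselI k (γ / h ^ 2) / besselI 0 (γ / h ^ 2))) : C = 0 := by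
  have hC : 0 ≤ C := by
    have := (norm_nonneg _).trans (ha 0)
    rwa [div_self (besselI_zero_pos _).ne', mul_one] at this
  have h1 : besselI 1 (γ / h ^ 2) / besselI 0 (γ / h ^ 2) < 0 :=
    div_neg_of_neg_of_pos (besselI_one_neg (div_neg_of_neg_of_pos hγ (by positivity)))
      (besselI_zero_pos _)
  have h2 := (norm_nonneg _).trans (ha 1)
  by_contra hne
  exact absurd h2 (not_le.2 (mul_neg_of_pos_of_neg (lt_of_le_of_ne hC (Ne.symm hne)) h1))

end DiscreteHardy

open DiscreteHardy in
theorem theorem3p1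
    -- a time interval `J` containing the times `0` and `1`
    (J : Set ℝ) (hJ : J.OrdConnected) (hJ0 : (0 : ℝ) ∈ J) (hJ1 : (1 : ℝ) ∈ J)
    -- `f h t k` is the value at time `t` and site `k` of the solution with mesh size `h`
    (f : ℝ → ℝ → ℤ → ℂ)
    (hf : ∀ h : ℝ, 0 < h → DiscreteHardy.IsDiscreteSchrodingerSolution h J (f h))
    -- `u₀` is the continuous representative of an element of `H^s(ℝ)`
    (s : ℝ) (hs : 1 / 2 < s)
    (u₀ : ℝ → ℂ) (hu₀_cont : Continuous u₀) (hu₀ : DiscreteHardy.MemHs s u₀)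
    (μ : ℝ) (hμ : 0 < μ)
    (hmesh : ∀ᶠ h : ℝ in 𝓝[>] 0,
      Summable (fun k : ℤ => ‖f h 0 k - u₀ (k * h)‖ ^ 2) ∧
        ∑' k : ℤ, ‖f h 0 k - u₀ (k * h)‖ ^ 2 < h ^ μ)
    (α β C : ℝ) (hαβ : α * β < 4)
    (hdecay0 : ∀ h : ℝ, 0 < h → ∀ k : ℤ,
      ‖f h 0 k‖ ≤ C * (DiscreteHardy.besselI k (α / h ^ 2) / DiscreteHardy.besselI 0 (α / h ^ 2)))
    (hdecay1 : ∀ h : ℝ, 0 < h → ∀ k : ℤ,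
      ‖f h 1 k‖ ≤ C * (DiscreteHardy.besselI k (β / h ^ 2) / DiscreteHardy.besselI 0 (β / h ^ 2))) :
    (∀ x : ℝ, u₀ x = 0) ∧
      ∀ t ∈ J, TendstoUniformly (fun (h : ℝ) (k : ℤ) => f h t k) (fun _ => 0) (𝓝[>] 0) := by
  have hpow : Tendsto (fun h : ℝ => √(h ^ μ)) (𝓝[>] 0) (𝓝 0) := by
    have h1 : Tendsto (fun h : ℝ => √(h ^ μ)) (𝓝 0) (𝓝 √((0 : ℝ) ^ μ)) :=
      (Real.continuousAt_rpow_const 0 μ (Or.inr hμ.le)).sqrt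
    rw [Real.zero_rpow hμ.ne', Real.sqrt_zero] at h1
    exact h1.mono_left nhdsWithin_le_nhds
  -- The ℓ² error dominates the error at the single site ⌊x/h⌋, and u₀ is continuous.
  have hlim : ∀ x, Tendsto (fun h => f h 0 ⌊x / h⌋) (𝓝[>] 0) (𝓝 (u₀ x)) := by
    intro x
    have h1 := (hu₀_cont.tendsto x).comp (tendsto_floor_div_mul x)
    have h2 : Tendsto (fun h => f h 0 ⌊x / h⌋ - u₀ (⌊x / h⌋ * h)) (𝓝[>] 0) (𝓝 0) := by
      refine squeeze_zero_norm' ?_ hpow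
      filter_upwards [hmesh] with h hh
      exact Real.le_sqrt_of_sq_le
        ((hh.1.le_tsum ⌊x / h⌋ fun j _ => by positivity).trans hh.2.le)
    simpa using h2.add h1
  -- The Chernoff bound needs nonnegative arguments. A negative α or β makes the bound at k = 1
  -- negative unless C = 0; then the data vanish at both times and both parameters may be replaced
  -- by 0.
  obtain ⟨α', β', hα', hβ', hαβ', ha, hb⟩ : ∃ α' β' : ℝ, 0 ≤ α' ∧ 0 ≤ β' ∧ α' * β' < 4 ∧
      (∀ h, 0 < h → BesselDecay C α' h (f h 0)) ∧ (∀ h, 0 < h → BesselDecay C β' h (f h 1)) := by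
    by_cases hneg : α < 0 ∨ β < 0
    · have hC : C = 0 := by
        rcases hneg with h | h
        · exact eq_zero_of_le_besselI_neg h one_pos (hdecay0 1 one_pos)
        · exact eq_zero_of_le_besselI_neg h one_pos (hdecay1 1 one_pos)
      refine ⟨0, 0, le_rfl, le_rfl, by norm_num, fun h hh k η => ?_, fun h hh k η => ?_⟩
      · simpa [hC] using hdecay0 h hh k
      · simpa [hC] using hdecay1 h hh k
    · push Not at hneg
      exact ⟨α, β, hneg.1, hneg.2, hαβ, fun h hh => besselDecay_of_le hneg.1 (hdecay0 h hh),
        fun h hh => besselDecay_of_le hneg.2 (hdecay1 h hh)⟩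
  have hsum : ∀ {γ h : ℝ} {a : ℤ → ℂ}, 0 < h → BesselDecay C γ h a → Summable fun k => ‖a k‖ := by
    intro γ h a hh h'
    obtain ⟨K, hK⟩ := h'.exists_bound hh 1
    refine Summable.of_nonneg_of_le (fun _ => norm_nonneg _) hK ?_
    simpa using summable_exp_neg_abs_int.mul_left K
  have hu : ∀ x, u₀ x = 0 := eq_zero_of_mesh_limit hu₀_cont hα' hβ' hαβ' ha hb
    (fun h hh θ => (hf h hh).fourier_eq hJ hJ0 hJ1 (hsum hh (ha h hh)) (hsum hh (hb h hh)) θ) hlim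
  refine ⟨hu, fun t ht => ?_⟩
  rw [Metric.tendstoUniformly_iff]
  intro ε hε
  filter_upwards [self_mem_nhdsWithin, hmesh, hpow.eventually_lt_const hε] with h hh hm hlt k
  simp only [hu, sub_zero] at hm
  obtain ⟨M, hM⟩ := (hf h hh).l2_bounded {t} (Set.singleton_subset_iff.2 ht) isCompact_singleton
  -- With u₀ = 0 the mesh hypothesis bounds the squared ℓ² norm at time 0, which is conserved up to
  -- time t.
  have h1 : ‖f h t k‖ ^ 2 ≤ h ^ μ :=
    ((hM t rfl).1.le_tsum k fun j _ => by positivity).trans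
      (((hf h hh).tsum_norm_sq_eq hJ hJ0 ht).trans_le hm.2.le)
  rw [dist_zero_left]
  exact (Real.le_sqrt_of_sq_le h1).trans_lt hlt
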